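/- Let $G$ be a finite, simple, connected graph with vertex set $V(G)$, edge set $E(G)$ and distance function $d_G$. For vertices $s,t$ let $n_G(s,t)$ be the number of vertices strictly closer to $s$ than to $t$, and let $o_G(s,t)$ be the number of vertices with equal distance to $s$ and $t$. Define the Wiener index and the revised Szeged index by $$W(G)=\sum_{\{u,v\}\subseteq V(G)} d_G(u,v)=\frac12\sum_{u,v\in V(G)} d_G(u,v),$$ $$\mathrm{Sz}^*(G)=\sum_{\{s,t\}\in E(G)}\Bigl(n_G(s,t)+\tfrac12\,o_G(s,t)\Bigr)\Bigl(n_G(t,s)+\tfrac12\,o_G(t,s)\Bigr).$$ A block of $G$ is a maximal connected subgraph with at least two vertices and without a cut vertex of its own (so a bridge together with its end points is a block). Suppose that every block of $G$ is a cycle (of length at least $3$). Then $$2\,W(G)\le \mathrm{Sz}^*(G),$$ with equality if and only if every cycle in $G$ has even length. -/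

import Mathlib

namespace SzegedCactus

universe u

variable {V : Type u}

/-- A subgraph is nonseparable if it is connected, has at least two vertices, and has no cut
vertex: deleting any single one of its vertices leaves a connected graph. A single edge together
with its two end points is nonseparable. -/
def IsNonseparable {G : SimpleGraph V} (H : G.Subgraph) : Prop :=
  H.Connected ∧ H.verts.Nontrivial ∧ ∀ v ∈ H.verts, (H.deleteVerts {v}).Connected

/-- A block of `G` is a maximal nonseparable subgraph (so bridges are blocks too). -/
def IsBlock {G : SimpleGraph V} (B : G.Subgraph) : Prop :=
  Maximal IsNonseparable B

/-- The subgraph `H` is a cycle (of length at least three): it consists of exactly the vertices and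
edges of some cycle of `G`. -/
def IsCycleSubgraph {G : SimpleGraph V} (H : G.Subgraph) : Prop :=
  ∃ (v : V) (c : G.Walk v v), c.IsCycle ∧ c.toSubgraph = H

section Indices

variable [Fintype V] (G : SimpleGraph V)

/-- The number of vertices closer to `s` than to `t`. -/
noncomputable def closerCount (s t : V) : ℕ :=
  (Finset.univ.filter fun x => G.dist x s < G.dist x t).card

/-- The number of vertices with equal distance to `s` and `t`. -/
noncomputable def equalCount (s t : V) : ℕ :=
  (Finset.univ.filter fun x => G.dist x s = G.dist x t).card

/-- The Wiener index: the sum of the distances over all unordered pairs of vertices, that is, half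
the sum over all ordered pairs. -/
noncomputable def wienerIndex : ℚ :=
  (1 / 2) * ∑ u : V, ∑ v : V, (G.dist u v : ℚ)

/-- The contribution of the unordered pair `{s, t}` to the revised Szeged index. -/
noncomputable def revisedSzegedTerm : Sym2 V → ℚ :=
  Sym2.lift ⟨fun s t => ((closerCount G s t : ℚ) + (1 / 2) * (equalCount G s t : ℚ)) *
      ((closerCount G t s : ℚ) + (1 / 2) * (equalCount G t s : ℚ)),
    fun _ _ => mul_comm _ _⟩

open Classical in
/-- The revised Szeged index: the sum over all edges `{s, t}` of
`(n(s, t) + o(s, t) / 2) * (n(t, s) + o(t, s) / 2)`. -/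
noncomputable def revisedSzegedIndex : ℚ :=
  ∑ e ∈ G.edgeFinset, revisedSzegedTerm G e

end Indices

end SzegedCactus

/-! For an edge `st` put `f(x) = d(x,t) - d(x,s)`, a number in `{-1, 0, 1}`. A vertex `x`
contributes `(1 + f(x))/2` and `(1 - f(x))/2` to the two factors, so the edge term is a quarter of
the sum of `1 - f(u) f(v)` over ordered pairs (`revisedSzegedTerm_eq`).

As blocks are cycles, the cycles partition the edges, and every vertex has a unique projection to
each cycle (`exists_cycleSystem`). Distances add up over the projections
(`CycleSystem.dist_eq_projDist`), so on the edges of one cycle `f(x)` depends only on the projection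
of `x`. Summation by parts around the cycle turns `∑ (1 - f(u) f(v))` into four times the distance
of the projections, plus 1 if the cycle is odd and they coincide (`sum_one_sub_cycDist_mul`).

Hence `Sz* - 2W` is a quarter of the number of triples (odd cycle, `u`, `v`) with equal projections.
The triples with `u = v` make it positive as soon as an odd cycle exists. -/

namespace SzegedCactus

universe u

variable {V : Type u}

/-- The distance of `r` from `0` in the cycle graph on `ZMod n`. -/
def cycDist {n : ℕ} (r : ZMod n) : ℤ := min (r.val : ℤ) (n - r.val)

/-! ### Distances in a single cycle. -/

section CycDist

variable {n : ℕ}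

@[simp]
lemma cycDist_zero : cycDist (0 : ZMod n) = 0 := by
  simp [cycDist]

lemma val_half (hn : 2 ≤ n) : ((n / 2 : ℕ) : ZMod n).val = n / 2 :=
  ZMod.val_cast_of_lt (by omega)

lemma val_neg_half (hn : 2 ≤ n) : (-((n / 2 : ℕ) : ZMod n)).val = n - n / 2 := by
  have h : -((n / 2 : ℕ) : ZMod n) = ((n - n / 2 : ℕ) : ZMod n) := by
    rw [Nat.cast_sub (by omega)]
    simp
  rw [h]
  exact ZMod.val_cast_of_lt (by omega)

lemma sym2_succ_injective (hn : 3 ≤ n) {c : ZMod n → V} (hc : Function.Injective c) :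
    Function.Injective fun i => s(c i, c (i + 1)) := by
  intro i j h
  have hij : s(i, i + 1) = s(j, j + 1) := Sym2.map.injective hc h
  rcases Sym2.eq_iff.mp hij with h | h
  · exact h.1
  · exfalso
    have h2 : ((2 : ℕ) : ZMod n) = 0 := by
      push_cast
      linear_combination h.2 - h.1
    rw [ZMod.natCast_eq_zero_iff] at h2
    exact absurd (Nat.le_of_dvd (by norm_num) h2) (by omega)

variable [NeZero n]

lemma val_add_one_eq (hn : 2 ≤ n) (r : ZMod n) :
    (r + 1).val = if r.val + 1 = n then 0 else r.val + 1 := by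
  have : Fact (1 < n) := ⟨hn⟩
  have h := ZMod.val_lt r
  rw [ZMod.val_add, ZMod.val_one]
  split_ifs with h1
  · rw [h1, Nat.mod_self]
  · exact Nat.mod_eq_of_lt (by omega)

lemma val_sub_one_eq (hn : 2 ≤ n) (r : ZMod n) :
    (r - 1).val = if r.val = 0 then n - 1 else r.val - 1 := by
  have h := val_add_one_eq hn (r - 1)
  have h' := ZMod.val_lt (r - 1)
  rw [sub_add_cancel] at h
  split_ifs at h ⊢ <;> omega

lemma cycDist_nonneg (r : ZMod n) : 0 ≤ cycDist r := by
  have := ZMod.val_lt r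
  unfold cycDist
  omega

lemma cycDist_add_one_le (hn : 2 ≤ n) (r : ZMod n) : cycDist (r + 1) ≤ cycDist r + 1 := by
  have := ZMod.val_lt r
  unfold cycDist
  rw [val_add_one_eq hn]
  split_ifs <;> omega

lemma cycDist_le_add_one (hn : 2 ≤ n) (r : ZMod n) : cycDist r ≤ cycDist (r + 1) + 1 := by
  have := ZMod.val_lt r
  unfold cycDist
  rw [val_add_one_eq hn]
  split_ifs <;> omega

lemma exists_cycDist_eq_sub_one (hn : 2 ≤ n) {r : ZMod n} (hr : r ≠ 0) :
    cycDist (r + 1) = cycDist r - 1 ∨ cycDist (r - 1) = cycDist r - 1 := by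
  have := ZMod.val_lt r
  have h0 : r.val ≠ 0 := by rwa [Ne, ZMod.val_eq_zero]
  unfold cycDist
  rw [val_add_one_eq hn, val_sub_one_eq hn]
  split_ifs <;> omega

lemma val_add_eq (a b : ZMod n) :
    (a + b).val = if a.val + b.val < n then a.val + b.val else a.val + b.val - n := by
  have ha := ZMod.val_lt a
  have hb := ZMod.val_lt b
  split_ifs with h
  · exact ZMod.val_add_of_lt h
  · have := ZMod.val_add_val_of_le (not_lt.mp h)
    omega

/-- The distance is piecewise linear with a kink at 0 and at the antipodes `±(n / 2)`. These
coincide for even `n`, and their contributions then add up. -/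
lemma cycDist_second_difference (hn : 2 ≤ n) (r : ZMod n) :
    cycDist (r + 1) + cycDist (r - 1) - 2 * cycDist r =
      2 * (if r = 0 then 1 else 0) - (if r = (n / 2 : ℕ) then 1 else 0) -
        (if r = -((n / 2 : ℕ) : ZMod n) then 1 else 0) := by
  have hr := ZMod.val_lt r
  have e0 : r = 0 ↔ r.val = 0 := (ZMod.val_eq_zero r).symm
  have e1 : r = (n / 2 : ℕ) ↔ r.val = n / 2 := by
    rw [← (ZMod.val_injective n).eq_iff, val_half hn]
  have e2 : r = -((n / 2 : ℕ) : ZMod n) ↔ r.val = n - n / 2 := by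
    rw [← (ZMod.val_injective n).eq_iff, val_neg_half hn]
  simp only [e0, e1, e2]
  unfold cycDist
  rw [val_add_one_eq hn, val_sub_one_eq hn]
  split_ifs <;> omega

/-- The distances of `r` to 0 and to an antipode add up to `n / 2`, for even `n`. For odd `n` one
antipode of `r ≠ 0` is a step farther away, while at `r = 0` both are at `(n - 1) / 2`, which leaves
the defect 1. -/
lemma two_mul_cycDist_add_half (hn : 2 ≤ n) (r : ZMod n) :
    2 * cycDist r + cycDist (r + ((n / 2 : ℕ) : ZMod n)) +
      cycDist (r - ((n / 2 : ℕ) : ZMod n)) +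
      (if Odd n ∧ r = 0 then 1 else 0) = n := by
  have hr := ZMod.val_lt r
  have e0 : Odd n ∧ r = 0 ↔ n % 2 = 1 ∧ r.val = 0 := by
    rw [ZMod.val_eq_zero, Nat.odd_iff]
  simp only [e0, sub_eq_add_neg]
  unfold cycDist
  rw [val_add_eq, val_add_eq, val_half hn, val_neg_half hn]
  split_ifs <;> omega

/-- Summation over the edges `{i, i + 1}` of a cycle recovers the distance of two of its
vertices, with a defect on the diagonal if the cycle is odd. -/
lemma sum_one_sub_cycDist_mul (hn : 2 ≤ n) (p q : ZMod n) :
    ∑ i : ZMod n, (1 - (cycDist (p - (i + 1)) - cycDist (p - i)) *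
        (cycDist (q - (i + 1)) - cycDist (q - i))) =
      4 * cycDist (p - q) + if Odd n ∧ p = q then 1 else 0 := by
  set a : ZMod n → ℤ := fun i => cycDist (p - i) with ha
  set b : ZMod n → ℤ := fun i => cycDist (q - i) with hb
  -- Summation by parts; going around a cycle leaves no boundary terms.
  have hshift : ∑ i : ZMod n, a (i + 1) * (b (i + 1) - b i) = ∑ i, a i * (b i - b (i - 1)) := by
    rw [← Equiv.sum_comp (Equiv.addRight (1 : ZMod n)) fun i => a i * (b i - b (i - 1))]
    simp
  have hparts : ∑ i : ZMod n, (a (i + 1) - a i) * (b (i + 1) - b i) =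
      -∑ i, a i * (b (i + 1) + b (i - 1) - 2 * b i) := by
    simp only [sub_mul (a _)]
    rw [Finset.sum_sub_distrib, hshift, ← Finset.sum_sub_distrib, ← Finset.sum_neg_distrib]
    exact Finset.sum_congr rfl fun i _ => by ring
  have hb2 (i : ZMod n) : b (i + 1) + b (i - 1) - 2 * b i =
      2 * (if i = q then 1 else 0) - (if i = q - (n / 2 : ℕ) then 1 else 0) -
        (if i = q + (n / 2 : ℕ) then 1 else 0) := by
    have h := cycDist_second_difference hn (q - i)
    have e1 : q - (i + 1) = q - i - 1 := by ring
    have e2 : q - (i - 1) = q - i + 1 := by ring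
    have e3 : q - i = 0 ↔ i = q := by rw [sub_eq_zero, eq_comm]
    have e4 : q - i = (n / 2 : ℕ) ↔ i = q - (n / 2 : ℕ) := by
      constructor <;> intro h <;> linear_combination -h
    have e5 : q - i = -((n / 2 : ℕ) : ZMod n) ↔ i = q + (n / 2 : ℕ) := by
      constructor <;> intro h <;> linear_combination -h
    simp only [e3, e4, e5] at h
    simp only [hb, e1, e2]
    linarith
  have hsum : ∑ i : ZMod n, (a (i + 1) - a i) * (b (i + 1) - b i) =
      a (q - (n / 2 : ℕ)) + a (q + (n / 2 : ℕ)) - 2 * a q := by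
    rw [hparts]
    simp only [hb2, mul_sub, Finset.sum_sub_distrib, mul_ite, mul_one, mul_zero,
      Finset.sum_ite_eq', Finset.mem_univ, if_true]
    ring
  rw [Finset.sum_sub_distrib, hsum]
  have hhalf := two_mul_cycDist_add_half hn (p - q)
  have e1 : p - (q - (n / 2 : ℕ)) = p - q + (n / 2 : ℕ) := by ring
  have e2 : p - (q + (n / 2 : ℕ)) = p - q - (n / 2 : ℕ) := by ring
  simp only [sub_eq_zero] at hhalf
  simp only [ha, e1, e2, Finset.sum_const, Finset.card_univ, ZMod.card, nsmul_eq_mul, mul_one]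
  linarith

end CycDist

/-- A decomposition of the edge set of `G` into cycles, indexed by `ι`, together with the
projections of the vertices of `G` to those cycles: edges outside a cycle are contracted by the
projection to that cycle. -/
structure CycleSystem (G : SimpleGraph V) (ι : Type*) where
  order : ι → ℕ
  vert : ∀ k, ZMod (order k) → V
  proj : ∀ k, V → ZMod (order k)
  three_le : ∀ k, 3 ≤ order k
  adj : ∀ k i, G.Adj (vert k i) (vert k (i + 1))
  exists_of_adj : ∀ {u v}, G.Adj u v → ∃ k i, s(u, v) = s(vert k i, vert k (i + 1))
  eq_of_edge_eq : ∀ {k l i j},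
    s(vert k i, vert k (i + 1)) = s(vert l j, vert l (j + 1)) → k = l
  proj_vert : ∀ k i, proj k (vert k i) = i
  proj_eq : ∀ {u v}, G.Adj u v → ∀ k, (∀ i, s(u, v) ≠ s(vert k i, vert k (i + 1))) →
    proj k u = proj k v

/-! ### Distances as sums over the cycles. -/

namespace CycleSystem

variable {G : SimpleGraph V} {ι : Type*} (S : CycleSystem G ι)

instance (k : ι) : NeZero (S.order k) :=
  ⟨by have := S.three_le k; omega⟩

lemma two_le (k : ι) : 2 ≤ S.order k :=
  (by norm_num : 2 ≤ 3).trans (S.three_le k)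

lemma vert_injective (k : ι) : Function.Injective (S.vert k) := fun i j h => by
  rw [← S.proj_vert k i, h, S.proj_vert]

lemma edge_injective (k : ι) :
    Function.Injective fun i : ZMod (S.order k) => s(S.vert k i, S.vert k (i + 1)) :=
  sym2_succ_injective (S.three_le k) (S.vert_injective k)

lemma sum_edgeFinset [Fintype ι] [Fintype G.edgeSet] {M : Type*} [AddCommMonoid M]
    (F : Sym2 V → M) :
    ∑ e ∈ G.edgeFinset, F e = ∑ k, ∑ i, F s(S.vert k i, S.vert k (i + 1)) := by
  rw [← Fintype.sum_sigma']
  symm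
  refine Finset.sum_bij (fun x _ => s(S.vert x.1 x.2, S.vert x.1 (x.2 + 1))) ?_ ?_ ?_ ?_
  · intro x _
    simpa using S.adj x.1 x.2
  · rintro ⟨k, i⟩ _ ⟨l, j⟩ _ h
    obtain rfl := S.eq_of_edge_eq h
    obtain rfl := S.edge_injective k h
    rfl
  · intro e he
    induction e with | _ u v
    obtain ⟨k, i, h⟩ := S.exists_of_adj (by simpa using he : G.Adj u v)
    exact ⟨⟨k, i⟩, Finset.mem_univ _, h.symm⟩
  · intro _ _
    rfl

lemma proj_vert_add_one_of_ne {k l : ι} (h : l ≠ k) (i : ZMod (S.order k)) :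
    S.proj l (S.vert k (i + 1)) = S.proj l (S.vert k i) :=
  (S.proj_eq (S.adj k i) l fun _ hj => h (S.eq_of_edge_eq hj).symm).symm

/-- A walk that avoids a vertex of a cycle does not enter the fibre over that vertex. -/
lemma proj_ne_of_notMem_support {k : ι} {j : ZMod (S.order k)} {u v : V} (p : G.Walk u v)
    (hu : S.proj k u ≠ j) (hp : S.vert k j ∉ p.support) : S.proj k v ≠ j := by
  induction p with
  | nil => exact hu
  | @cons u w v h p ih =>
    rw [SimpleGraph.Walk.support_cons, List.mem_cons, not_or] at hp
    refine ih ?_ hp.2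
    -- An edge of the cycle leads to a cycle vertex, which is its own projection; any other edge
    -- preserves the projection.
    by_cases hk : ∃ i, s(u, w) = s(S.vert k i, S.vert k (i + 1))
    · have hw : ∃ i, w = S.vert k i := by
        obtain ⟨i, hi⟩ := hk
        rcases Sym2.eq_iff.mp hi with hi | hi
        exacts [⟨_, hi.2⟩, ⟨_, hi.2⟩]
      obtain ⟨i, rfl⟩ := hw
      rw [S.proj_vert]
      rintro rfl
      exact hp.2 p.start_mem_support
    · rwa [← S.proj_eq h k (by simpa using hk)]

section Dist

variable [Fintype ι]

/-- The sum of the distances of the projections of `u` and `v` to all cycles. -/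
def projDist (u v : V) : ℤ := ∑ k, cycDist (S.proj k u - S.proj k v)

lemma projDist_vert_add_one_sub (k : ι) (i : ZMod (S.order k)) (v : V) :
    S.projDist (S.vert k (i + 1)) v - S.projDist (S.vert k i) v =
      cycDist (i + 1 - S.proj k v) - cycDist (i - S.proj k v) := by
  unfold projDist
  rw [← Finset.sum_sub_distrib, Finset.sum_eq_single k]
  · rw [S.proj_vert, S.proj_vert]
  · intro l _ hl
    rw [S.proj_vert_add_one_of_ne hl, sub_self]
  · simp

lemma projDist_le_of_adj {u w : V} (h : G.Adj u w) (v : V) :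
    S.projDist u v ≤ S.projDist w v + 1 := by
  obtain ⟨k, i, hi⟩ := S.exists_of_adj h
  have h0 := S.projDist_vert_add_one_sub k i v
  have h1 := cycDist_add_one_le (S.two_le k) (i - S.proj k v)
  have h2 := cycDist_le_add_one (S.two_le k) (i - S.proj k v)
  rw [sub_add_eq_add_sub] at h1 h2
  rcases Sym2.eq_iff.mp hi with ⟨rfl, rfl⟩ | ⟨rfl, rfl⟩ <;> linarith

lemma projDist_self (u : V) : S.projDist u u = 0 := by
  simp [projDist]

lemma projDist_nonneg (u v : V) : 0 ≤ S.projDist u v :=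
  Finset.sum_nonneg fun _ _ => cycDist_nonneg _

lemma projDist_le_length {u v : V} (p : G.Walk u v) : S.projDist u v ≤ p.length := by
  induction p with
  | nil => simp [S.projDist_self]
  | @cons u w v h p ih =>
    have := S.projDist_le_of_adj h v
    rw [SimpleGraph.Walk.length_cons]
    push_cast
    linarith

/-- The first edge of a path to `v` lies on some cycle. The path never returns to `u`, so `v` does
not project to `u` there, and one of the two neighbours of `u` on that cycle, not necessarily the
one on the path, is closer. -/
lemma exists_adj_projDist_eq (hG : G.Connected) {u v : V} (huv : u ≠ v) :
    ∃ w, G.Adj u w ∧ S.projDist w v = S.projDist u v - 1 := by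
  obtain ⟨p, hp⟩ := hG.preconnected.exists_isPath u v
  cases p with
  | nil => exact absurd rfl huv
  | @cons _ w _ h p =>
    rw [SimpleGraph.Walk.cons_isPath_iff] at hp
    obtain ⟨k, i, hi⟩ := S.exists_of_adj h
    have huw : ∃ j j', u = S.vert k j ∧ w = S.vert k j' := by
      rcases Sym2.eq_iff.mp hi with hi | hi
      exacts [⟨_, _, hi⟩, ⟨_, _, hi⟩]
    obtain ⟨j, j', rfl, rfl⟩ := huw
    have hj : S.proj k v ≠ j := by
      refine S.proj_ne_of_notMem_support p ?_ hp.2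
      rw [S.proj_vert]
      rintro rfl
      exact h.ne rfl
    rcases exists_cycDist_eq_sub_one (S.two_le k) (sub_ne_zero.mpr hj.symm) with h1 | h1
    · refine ⟨_, S.adj k j, ?_⟩
      have := S.projDist_vert_add_one_sub k j v
      rw [sub_add_eq_add_sub] at h1
      linarith
    · have hadj := S.adj k (j - 1)
      have := S.projDist_vert_add_one_sub k (j - 1) v
      rw [sub_add_cancel] at hadj this
      refine ⟨_, hadj.symm, ?_⟩
      rw [sub_right_comm] at h1
      linarith

lemma dist_le_projDist (hG : G.Connected) (m : ℕ) {u v : V} (h : S.projDist u v = m) :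
    G.dist u v ≤ m := by
  induction m generalizing u with
  | zero =>
    by_contra hne
    have huv : u ≠ v := by
      rintro rfl
      simp at hne
    obtain ⟨w, -, hw⟩ := S.exists_adj_projDist_eq hG huv
    have := S.projDist_nonneg w v
    push_cast at h
    linarith
  | succ m ih =>
    have huv : u ≠ v := by
      rintro rfl
      rw [S.projDist_self] at h
      norm_cast at h
    obtain ⟨w, hadj, hw⟩ := S.exists_adj_projDist_eq hG huv
    have h1 := ih (u := w) (by push_cast at h; linarith)
    have h2 := hG.dist_triangle (u := u) (v := w) (w := v)
    rw [SimpleGraph.dist_eq_one_iff_adj.mpr hadj] at h2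
    omega

/-- The distance in `G` is the sum of the distances in the cycles. -/
theorem dist_eq_projDist (hG : G.Connected) (u v : V) : (G.dist u v : ℤ) = S.projDist u v := by
  apply le_antisymm
  · obtain ⟨m, hm⟩ := Int.eq_ofNat_of_zero_le (S.projDist_nonneg u v)
    rw [hm]
    exact_mod_cast S.dist_le_projDist hG m hm
  · obtain ⟨p, hp⟩ := hG.exists_walk_length_eq_dist u v
    rw [← hp]
    exact S.projDist_le_length p

lemma dist_vert_add_one_sub (hG : G.Connected) (k : ι) (i : ZMod (S.order k)) (x : V) :
    (G.dist x (S.vert k (i + 1)) : ℤ) - G.dist x (S.vert k i) =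
      cycDist (S.proj k x - (i + 1)) - cycDist (S.proj k x - i) := by
  rw [S.dist_eq_projDist hG, S.dist_eq_projDist hG, projDist, projDist,
    ← Finset.sum_sub_distrib, Finset.sum_eq_single k]
  · rw [S.proj_vert, S.proj_vert]
  · intro l _ hl
    rw [S.proj_vert_add_one_of_ne hl, sub_self]
  · simp

end Dist

end CycleSystem

/-! ### Edge terms of the revised Szeged index. -/

lemma dist_le_dist_add_one_of_adj {G : SimpleGraph V} {s t : V} (hG : G.Connected) (h : G.Adj s t) (x : V) :
    (G.dist x t : ℤ) ≤ G.dist x s + 1 ∧ (G.dist x s : ℤ) ≤ G.dist x t + 1 := by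
  have h1 := hG.dist_triangle (u := x) (v := s) (w := t)
  have h2 := hG.dist_triangle (u := x) (v := t) (w := s)
  rw [SimpleGraph.dist_eq_one_iff_adj.mpr h] at h1
  rw [SimpleGraph.dist_eq_one_iff_adj.mpr h.symm] at h2
  omega

section Indices

variable [Fintype V] {G : SimpleGraph V}

lemma closerCount_add_half_equalCount {s t : V} (hG : G.Connected) (h : G.Adj s t) :
    (closerCount G s t : ℚ) + 1 / 2 * equalCount G s t =
      ∑ x, (1 + (((G.dist x t : ℤ) - G.dist x s : ℤ) : ℚ)) / 2 := by
  simp only [closerCount, equalCount, Finset.card_filter]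
  push_cast
  rw [Finset.mul_sum, ← Finset.sum_add_distrib]
  refine Finset.sum_congr rfl fun x _ => ?_
  obtain ⟨h1, h2⟩ := dist_le_dist_add_one_of_adj hG h x
  rcases lt_trichotomy (G.dist x s) (G.dist x t) with h3 | h3 | h3
  · have h4 : G.dist x t = G.dist x s + 1 := by omega
    simp [h4]
  · simp [h3]
  · have h4 : G.dist x s = G.dist x t + 1 := by omega
    simp [h4]

/-- With `N` vertices and `F = ∑ f(x)`, the term is `(N + F)/2 * (N - F)/2 = (N² - F²)/4`. -/
lemma revisedSzegedTerm_eq {s t : V} (hG : G.Connected) (h : G.Adj s t) :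
    revisedSzegedTerm G s(s, t) = 1 / 4 * ∑ u, ∑ v,
      ((1 - ((G.dist u t : ℤ) - G.dist u s) * ((G.dist v t : ℤ) - G.dist v s) : ℤ) : ℚ) := by
  set f : V → ℚ := fun x => (((G.dist x t : ℤ) - G.dist x s : ℤ) : ℚ) with hf
  have h1 : revisedSzegedTerm G s(s, t) = (∑ x, (1 + f x) / 2) * ∑ x, (1 - f x) / 2 := by
    have h2 := closerCount_add_half_equalCount hG h.symm
    have h3 (x : V) : (1 + (((G.dist x s : ℤ) - G.dist x t : ℤ) : ℚ)) / 2 = (1 - f x) / 2 := by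
      simp only [hf]
      push_cast
      ring
    simp only [h3] at h2
    rw [← closerCount_add_half_equalCount hG h, ← h2]
    rfl
  have h2 : ∑ u, ∑ v,
      ((1 - ((G.dist u t : ℤ) - G.dist u s) * ((G.dist v t : ℤ) - G.dist v s) : ℤ) : ℚ) =
      (Fintype.card V : ℚ) * Fintype.card V - (∑ x, f x) * ∑ x, f x := by
    rw [Finset.sum_mul_sum]
    simp only [hf]
    push_cast
    simp [Finset.sum_sub_distrib]
  rw [h1, h2, ← Finset.sum_div, ← Finset.sum_div, Finset.sum_add_distrib,
    Finset.sum_sub_distrib]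
  simp
  ring

open Classical in
/-- The difference of the revised Szeged index and twice the Wiener index is concentrated on the
odd cycles. -/
theorem CycleSystem.revisedSzegedIndex_eq {ι : Type*} [Fintype ι] (S : CycleSystem G ι)
    (hG : G.Connected) :
    revisedSzegedIndex G = 2 * wienerIndex G +
      1 / 4 * ∑ k, ∑ u, ∑ v, if Odd (S.order k) ∧ S.proj k u = S.proj k v then (1 : ℚ) else 0 := by
  have hterm (k : ι) : ∑ i, revisedSzegedTerm G s(S.vert k i, S.vert k (i + 1)) =
      1 / 4 * ∑ u, ∑ v, ((4 * cycDist (S.proj k u - S.proj k v) +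
        if Odd (S.order k) ∧ S.proj k u = S.proj k v then 1 else 0 : ℤ) : ℚ) := by
    simp only [revisedSzegedTerm_eq hG (S.adj k _), S.dist_vert_add_one_sub hG,
      ← sum_one_sub_cycDist_mul (S.two_le k)]
    rw [← Finset.mul_sum, Finset.sum_comm]
    congr 1
    refine Finset.sum_congr rfl fun u _ => ?_
    rw [Finset.sum_comm]
    refine Finset.sum_congr rfl fun v _ => ?_
    rw [Int.cast_sum]
  have hW : 2 * wienerIndex G =
      ∑ k, ∑ u, ∑ v, (cycDist (S.proj k u - S.proj k v) : ℚ) := by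
    have hd (u v : V) : (G.dist u v : ℚ) =
        ∑ k, (cycDist (S.proj k u - S.proj k v) : ℚ) := by
      rw [← Int.cast_sum]
      exact_mod_cast S.dist_eq_projDist hG u v
    simp only [wienerIndex, hd]
    rw [← mul_assoc, mul_one_div_cancel two_ne_zero, one_mul]
    symm
    rw [Finset.sum_comm]
    exact Finset.sum_congr rfl fun u _ => Finset.sum_comm
  rw [revisedSzegedIndex, S.sum_edgeFinset, hW, Finset.mul_sum, ← Finset.sum_add_distrib]
  refine Finset.sum_congr rfl fun k _ => ?_
  rw [hterm]
  push_cast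
  simp only [Finset.sum_add_distrib, ← Finset.mul_sum]
  ring

end Indices

/-! ### Nonseparable subgraphs. -/

section Nonseparable

variable {G : SimpleGraph V}

lemma IsNonseparable.connected_deleteVerts {H : G.Subgraph} (hH : IsNonseparable H) (v : V) :
    (H.deleteVerts {v}).Connected := by
  by_cases hv : v ∈ H.verts
  · exact hH.2.2 v hv
  · rw [← SimpleGraph.Subgraph.deleteVerts_inter_verts_left_eq,
      Set.inter_singleton_eq_empty.mpr hv, SimpleGraph.Subgraph.deleteVerts_empty]
    exact hH.1

/-- The union of two nonseparable subgraphs that share two vertices is nonseparable. -/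
lemma IsNonseparable.sup {H K : G.Subgraph} (hH : IsNonseparable H) (hK : IsNonseparable K)
    (h : (H.verts ∩ K.verts).Nontrivial) : IsNonseparable (H ⊔ K) := by
  refine ⟨SimpleGraph.Subgraph.connected_sup hH.1.preconnected hK.1.preconnected h.nonempty,
    hH.2.1.mono Set.subset_union_left, fun v _ => ?_⟩
  -- Of the two shared vertices, at least one survives the deletion of `v`.
  obtain ⟨x, hx, hxv⟩ := h.exists_ne v
  have hconn : (H.deleteVerts {v} ⊔ K.deleteVerts {v}).Connected :=
    SimpleGraph.Subgraph.connected_sup (hH.connected_deleteVerts v).preconnected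
      (hK.connected_deleteVerts v).preconnected ⟨x, ⟨hx.1, hxv⟩, ⟨hx.2, hxv⟩⟩
  refine hconn.mono (sup_le (SimpleGraph.Subgraph.deleteVerts_mono le_sup_left)
    (SimpleGraph.Subgraph.deleteVerts_mono le_sup_right)) ?_
  simp [Set.union_sdiff_distrib]

lemma isNonseparable_subgraphOfAdj {u v : V} (h : G.Adj u v) :
    IsNonseparable (G.subgraphOfAdj h) := by
  have key {a b x : V} (hab : G.Adj a b) (hx : x = a) :
      ((G.subgraphOfAdj hab).deleteVerts {x}).Connected := by
    subst hx
    have hverts : ((G.subgraphOfAdj hab).deleteVerts {x}).verts = {b} := by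
      ext y
      simp only [SimpleGraph.Subgraph.deleteVerts_verts, SimpleGraph.subgraphOfAdj_verts,
        Set.mem_sdiff, Set.mem_insert_iff, Set.mem_singleton_iff]
      constructor
      · tauto
      · rintro rfl
        exact ⟨Or.inr rfl, hab.ne'⟩
    refine (SimpleGraph.Subgraph.singletonSubgraph_connected (G := G) (v := b)).mono ?_ ?_
    · rw [SimpleGraph.singletonSubgraph_le_iff, hverts]
      rfl
    · rw [hverts]
      rfl
  refine ⟨SimpleGraph.Subgraph.subgraphOfAdj_connected h,
    ⟨u, by simp, v, by simp, h.ne⟩, fun x hx => ?_⟩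
  rcases hx with rfl | hx
  · exact key h rfl
  · have := key h.symm (Set.mem_singleton_iff.mp hx)
    rwa [SimpleGraph.subgraphOfAdj_symm] at this

end Nonseparable

/-! ### Cyclic enumeration of a cycle. -/

section CycleParam

variable {G : SimpleGraph V}

/-- The map `c` is a cyclic enumeration of the vertices of the cycle `H`. -/
structure IsCycleParam (H : G.Subgraph) (n : ℕ) (c : ZMod n → V) : Prop where
  three_le : 3 ≤ n
  injective : Function.Injective c
  verts_eq : H.verts = Set.range c
  adj_iff : ∀ u v, H.Adj u v ↔ ∃ i, s(u, v) = s(c i, c (i + 1))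

lemma exists_isCycleParam {v : V} {w : G.Walk v v} (hw : w.IsCycle) :
    ∃ c, IsCycleParam w.toSubgraph w.length c := by
  have h3 := hw.three_le_length
  have : NeZero w.length := ⟨by omega⟩
  have hsucc (i : ZMod w.length) : w.getVert (i + 1).val = w.getVert (i.val + 1) := by
    rw [val_add_one_eq (by omega)]
    split_ifs with h
    · rw [h, w.getVert_zero, w.getVert_length]
    · rfl
  refine ⟨fun i => w.getVert i.val, h3, ?_, ?_, ?_⟩
  · intro i j hij
    have hi := ZMod.val_lt i
    have hj := ZMod.val_lt j
    exact ZMod.val_injective _ (hw.getVert_injOn' (by simp; omega) (by simp; omega) hij)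
  · ext x
    rw [SimpleGraph.Walk.mem_verts_toSubgraph, SimpleGraph.Walk.mem_support_iff_exists_getVert]
    constructor
    · rintro ⟨m, rfl, hm⟩
      rcases hm.lt_or_eq with hm | rfl
      · exact ⟨m, by simp [ZMod.val_cast_of_lt hm]⟩
      · exact ⟨0, by simp⟩
    · rintro ⟨i, rfl⟩
      exact ⟨_, rfl, (ZMod.val_lt i).le⟩
  · intro x y
    rw [SimpleGraph.Walk.toSubgraph_adj_iff]
    constructor
    · rintro ⟨m, hxy, hm⟩
      refine ⟨m, ?_⟩
      rw [hsucc, ZMod.val_cast_of_lt hm, hxy]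
    · rintro ⟨i, hi⟩
      refine ⟨i.val, ?_, ZMod.val_lt i⟩
      rw [hi, hsucc]

namespace IsCycleParam

variable {H : G.Subgraph} {n : ℕ} {c : ZMod n → V}

lemma neZero (h : IsCycleParam H n c) : NeZero n :=
  ⟨by have := h.three_le; omega⟩

lemma mem_verts (h : IsCycleParam H n c) (i : ZMod n) : c i ∈ H.verts := by
  rw [h.verts_eq]
  exact ⟨i, rfl⟩

lemma adj (h : IsCycleParam H n c) (i : ZMod n) : H.Adj (c i) (c (i + 1)) :=
  (h.adj_iff _ _).mpr ⟨i, rfl⟩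

lemma natCard_verts (h : IsCycleParam H n c) : Nat.card H.verts = n := by
  rw [h.verts_eq, Nat.card_congr (Equiv.ofInjective c h.injective).symm, Nat.card_zmod]

/-- The arc runs through `j + 1, …, j + 1 + m`; the bound on `m` stops it before it comes back to
`j`. -/
lemma exists_walk (h : IsCycleParam H n c) (j : ZMod n) (m : ℕ) (hm : m + 1 < n) {x : V}
    (hx : x = c (j + 1 + m)) :
    ∃ p : G.Walk (c (j + 1)) x, p.toSubgraph ≤ H.deleteVerts {c j} := by
  have hne (l : ℕ) (hl : l + 1 < n) : c (j + 1 + l) ≠ c j := by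
    intro heq
    have h1 : ((l + 1 : ℕ) : ZMod n) = 0 := by
      push_cast
      linear_combination h.injective heq
    rw [ZMod.natCast_eq_zero_iff] at h1
    exact absurd (Nat.le_of_dvd (by omega) h1) (by omega)
  induction m generalizing x with
  | zero =>
    simp only [Nat.cast_zero, add_zero] at hx
    subst hx
    refine ⟨SimpleGraph.Walk.nil, ?_⟩
    have := hne 0 hm
    simp only [Nat.cast_zero, add_zero] at this
    simp [h.mem_verts, this]
  | succ m ih =>
    obtain ⟨p, hp⟩ := ih (by omega) rfl
    have hadj := h.adj (j + 1 + m)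
    have h1 := hne m (by omega)
    have h2 := hne (m + 1) hm
    rw [Nat.cast_succ, ← add_assoc] at hx h2
    subst hx
    refine ⟨p.append hadj.adj_sub.toWalk, ?_⟩
    rw [SimpleGraph.Walk.toSubgraph_append, SimpleGraph.Adj.toSubgraph_toWalk]
    refine sup_le hp (SimpleGraph.subgraphOfAdj_le_of_adj _ ?_)
    rw [SimpleGraph.Subgraph.deleteVerts_adj]
    exact ⟨hadj.fst_mem, h1, hadj.snd_mem, h2, hadj⟩

/-- Two vertices of a cycle are joined by an arc that avoids a given third vertex. -/
lemma exists_walk_of_ne (h : IsCycleParam H n c) {i j : ZMod n} (hij : i ≠ j) :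
    ∃ p : G.Walk (c (j + 1)) (c i), p.toSubgraph ≤ H.deleteVerts {c j} := by
  have := h.neZero
  have hlt := ZMod.val_lt (i - j - 1)
  refine h.exists_walk j (i - j - 1).val ?_ ?_
  · by_contra hge
    have h2 := h.three_le
    have h1 := val_add_one_eq (by omega) (i - j - 1)
    rw [if_pos (by omega), ZMod.val_eq_zero] at h1
    exact hij (by linear_combination h1)
  · rw [ZMod.natCast_zmod_val]
    congr 1
    ring

lemma connected_deleteVerts (h : IsCycleParam H n c) (j : ZMod n) :
    (H.deleteVerts {c j}).Connected := by
  have hex (x : V) (hx : x ∈ (H.deleteVerts {c j}).verts) :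
      ∃ p : G.Walk (c (j + 1)) x, p.toSubgraph ≤ H.deleteVerts {c j} := by
    obtain ⟨hx, hxj⟩ := hx
    rw [h.verts_eq] at hx
    obtain ⟨i, rfl⟩ := hx
    exact h.exists_walk_of_ne fun hij => hxj (by rw [hij]; rfl)
  rw [SimpleGraph.Subgraph.connected_iff_forall_exists_walk_subgraph]
  constructor
  · obtain ⟨p, hp⟩ := h.exists_walk j 0 (by have := h.three_le; omega) rfl
    exact ⟨_, hp.1 p.start_mem_verts_toSubgraph⟩
  · intro x y hx hy
    obtain ⟨p, hp⟩ := hex x hx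
    obtain ⟨q, hq⟩ := hex y hy
    refine ⟨p.reverse.append q, ?_⟩
    rw [SimpleGraph.Walk.toSubgraph_append, SimpleGraph.Walk.toSubgraph_reverse]
    exact sup_le hp hq

end IsCycleParam

lemma isNonseparable_toSubgraph {v : V} {w : G.Walk v v} (hw : w.IsCycle) :
    IsNonseparable w.toSubgraph := by
  obtain ⟨c, hc⟩ := exists_isCycleParam hw
  refine ⟨w.toSubgraph_connected, ⟨_, hc.mem_verts 0, _, hc.mem_verts (0 + 1), ?_⟩,
    fun x hx => ?_⟩
  · exact (hc.adj 0).ne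
  · rw [hc.verts_eq] at hx
    obtain ⟨j, rfl⟩ := hx
    exact hc.connected_deleteVerts j

/-- A cycle contained in another cycle is equal to it. -/
lemma toSubgraph_eq_of_le {u v : V} {w : G.Walk u u} {w' : G.Walk v v} (hw : w.IsCycle)
    (hw' : w'.IsCycle) (hle : w.toSubgraph ≤ w'.toSubgraph) : w.toSubgraph = w'.toSubgraph := by
  obtain ⟨c, hc⟩ := exists_isCycleParam hw'
  have := hc.neZero
  have hadj {x y : V} (hx : x ∈ w.toSubgraph.verts) (hxy : w'.toSubgraph.Adj x y) :
      w.toSubgraph.Adj x y := by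
    have h1 := hw.ncard_neighborSet_toSubgraph_eq_two (w.mem_verts_toSubgraph.mp hx)
    have h2 := hw'.ncard_neighborSet_toSubgraph_eq_two (w'.mem_verts_toSubgraph.mp (hle.1 hx))
    -- Both cycles have degree two at `x`, so the smaller neighbour set is the whole one.
    have h3 := Set.eq_of_subset_of_ncard_le
      (SimpleGraph.Subgraph.neighborSet_subset_of_subgraph hle x) (by rw [h1, h2])
      w'.finite_neighborSet_toSubgraph
    have h4 : y ∈ w'.toSubgraph.neighborSet x := hxy
    rwa [← h3] at h4
  have hu : u ∈ w.toSubgraph.verts := w.start_mem_verts_toSubgraph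
  obtain ⟨i, hi⟩ : u ∈ Set.range c := by
    rw [← hc.verts_eq]
    exact hle.1 hu
  have hmem (m : ℕ) : c (i + m) ∈ w.toSubgraph.verts := by
    induction m with
    | zero => simp [hi]
    | succ m ih =>
      rw [Nat.cast_succ, ← add_assoc]
      exact (hadj ih (hc.adj _)).snd_mem
  have hverts (x : V) (hx : x ∈ w'.toSubgraph.verts) : x ∈ w.toSubgraph.verts := by
    rw [hc.verts_eq] at hx
    obtain ⟨j, rfl⟩ := hx
    have h1 := hmem (j - i).val
    rwa [ZMod.natCast_zmod_val, add_sub_cancel] at h1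
  exact le_antisymm hle ⟨hverts, fun x y hxy => hadj (hverts x hxy.fst_mem) hxy⟩

end CycleParam

/-! ### From blocks to a cycle system. -/

section Blocks

variable {G : SimpleGraph V}

lemma exists_isCycle_le_of_isNonseparable [Finite V]
    (hblock : ∀ B : G.Subgraph, IsBlock B → IsCycleSubgraph B) {H : G.Subgraph}
    (hH : IsNonseparable H) : ∃ (v : V) (w : G.Walk v v), w.IsCycle ∧ H ≤ w.toSubgraph := by
  obtain ⟨B, hle, hB⟩ := Finite.exists_le_maximal hH
  obtain ⟨v, w, hw, rfl⟩ := hblock B hB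
  exact ⟨v, w, hw, hle⟩

lemma exists_isCycle_adj [Finite V]
    (hblock : ∀ B : G.Subgraph, IsBlock B → IsCycleSubgraph B) {a b : V} (h : G.Adj a b) :
    ∃ (v : V) (w : G.Walk v v), w.IsCycle ∧ w.toSubgraph.Adj a b := by
  obtain ⟨v, w, hw, hle⟩ :=
    exists_isCycle_le_of_isNonseparable hblock (isNonseparable_subgraphOfAdj h)
  exact ⟨v, w, hw, hle.2 (by simp)⟩

/-- If all blocks are cycles, two cycles with a common edge coincide. -/
lemma toSubgraph_eq_of_adj [Finite V]
    (hblock : ∀ B : G.Subgraph, IsBlock B → IsCycleSubgraph B) {u v a b : V} {w : G.Walk u u}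
    {w' : G.Walk v v} (hw : w.IsCycle) (hw' : w'.IsCycle) (h : w.toSubgraph.Adj a b)
    (h' : w'.toSubgraph.Adj a b) : w.toSubgraph = w'.toSubgraph := by
  obtain ⟨x, q, hq, hle⟩ := exists_isCycle_le_of_isNonseparable hblock
    ((isNonseparable_toSubgraph hw).sup (isNonseparable_toSubgraph hw')
      ⟨a, ⟨h.fst_mem, h'.fst_mem⟩, b, ⟨h.snd_mem, h'.snd_mem⟩, h.ne⟩)
  rw [toSubgraph_eq_of_le hw hq (le_sup_left.trans hle),
    toSubgraph_eq_of_le hw' hq (le_sup_right.trans hle)]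

/-- If all blocks are cycles, deleting two edges of a cycle separates their end points. -/
lemma not_reachable_deleteEdges_pair [Finite V]
    (hblock : ∀ B : G.Subgraph, IsBlock B → IsCycleSubgraph B) {v a b : V} {w : G.Walk v v}
    (hw : w.IsCycle) (hab : w.toSubgraph.Adj a b) {f : Sym2 V} (hf : f ∈ w.toSubgraph.edgeSet)
    (hne : f ≠ s(a, b)) : ¬ (G.deleteEdges {s(a, b), f}).Reachable a b := by
  intro hr
  obtain ⟨p, hp⟩ := hr.exists_isPath
  have hnot {e : Sym2 V} (he : e ∈ (p.mapLe (G.deleteEdges_le _)).edges) :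
      e ∉ ({s(a, b), f} : Set (Sym2 V)) := by
    rw [SimpleGraph.Walk.edges_mapLe_eq_edges] at he
    have := p.edges_subset_edgeSet he
    rw [SimpleGraph.edgeSet_deleteEdges] at this
    exact this.2
  -- A surviving path closes up with `ab` to a cycle that misses `f`, yet shares `ab` with `w` and
  -- so equals it.
  have hq : (SimpleGraph.Walk.cons hab.adj_sub.symm (p.mapLe (G.deleteEdges_le _))).IsCycle := by
    rw [SimpleGraph.Walk.cons_isCycle_iff]
    refine ⟨hp.mapLe _, fun hmem => hnot hmem ?_⟩
    rw [Sym2.eq_swap]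
    exact Set.mem_insert _ _
  have heq := toSubgraph_eq_of_adj hblock hw hq hab (by
    simp [SimpleGraph.Walk.toSubgraph, SimpleGraph.subgraphOfAdj_adj, Sym2.eq_swap])
  rw [heq, SimpleGraph.Walk.mem_edges_toSubgraph, SimpleGraph.Walk.edges_cons,
    List.mem_cons] at hf
  rcases hf with hf | hf
  · exact hne (hf.trans Sym2.eq_swap)
  · exact hnot hf (by simp)

/-- Otherwise, a connection from `c i` to `c j` off the cycle, followed by the arc from `c j` to `c
(i + 1)` avoiding `c i`, would bypass both cycle edges at `c i`. -/
lemma IsCycleParam.eq_of_reachable [Finite V]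
    (hblock : ∀ B : G.Subgraph, IsBlock B → IsCycleSubgraph B) {H : G.Subgraph} {n : ℕ}
    {c : ZMod n → V} (hc : IsCycleParam H n c) (hH : IsCycleSubgraph H) {i j : ZMod n}
    (h : (G.deleteEdges H.edgeSet).Reachable (c i) (c j)) : i = j := by
  by_contra hij
  obtain ⟨v, w, hw, rfl⟩ := hH
  have hprev := hc.adj (i - 1)
  rw [sub_add_cancel] at hprev
  have hne : s(c (i - 1), c i) ≠ s(c i, c (i + 1)) := by
    intro heq
    have h1 : i - 1 = i :=
      sym2_succ_injective hc.three_le hc.injective (by simpa only [sub_add_cancel] using heq)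
    have h2 := (hc.adj (i - 1)).ne
    rw [sub_add_cancel, h1] at h2
    exact h2 rfl
  refine not_reachable_deleteEdges_pair hblock hw (hc.adj i) hprev hne ?_
  have hsub : ({s(c i, c (i + 1)), s(c (i - 1), c i)} : Set (Sym2 V)) ⊆
      w.toSubgraph.edgeSet := by
    rintro e (rfl | rfl)
    exacts [hc.adj i, hprev]
  refine (h.mono (G.deleteEdges_anti hsub)).trans (SimpleGraph.Reachable.symm ?_)
  obtain ⟨p, hp⟩ := hc.exists_walk_of_ne (Ne.symm hij)
  refine ⟨p.toDeleteEdges _ fun e he hmem => ?_⟩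
  have hnot {x y : V} (hxy : s(x, y) ∈ p.edges) : x ≠ c i ∧ y ≠ c i := by
    have h1 : (w.toSubgraph.deleteVerts {c i}).Adj x y :=
      hp.2 (SimpleGraph.Walk.adj_toSubgraph_iff_mem_edges.mpr hxy)
    rw [SimpleGraph.Subgraph.deleteVerts_adj] at h1
    exact ⟨h1.2.1, h1.2.2.2.1⟩
  rcases hmem with rfl | rfl
  exacts [(hnot he).1 rfl, (hnot he).2 rfl]

/-- A walk from `x` to the cycle can be cut off before its first cycle edge. The vertex found serves
as the projection of `x`. -/
lemma IsCycleParam.exists_reachable (hG : G.Connected) {H : G.Subgraph} {n : ℕ} {c : ZMod n → V}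
    (hc : IsCycleParam H n c) (x : V) :
    ∃ i, (G.deleteEdges H.edgeSet).Reachable x (c i) := by
  obtain ⟨p⟩ := hG.preconnected x (c 0)
  generalize hy : c 0 = y at p
  induction p with
  | nil => exact ⟨0, by rw [hy]⟩
  | @cons u v _ h p ih =>
    obtain ⟨i, hi⟩ := ih hy
    by_cases huv : H.Adj u v
    · have hu := huv.fst_mem
      rw [hc.verts_eq] at hu
      obtain ⟨j, rfl⟩ := hu
      exact ⟨j, .rfl⟩
    · have hadj : (G.deleteEdges H.edgeSet).Adj u v := by
        rw [SimpleGraph.deleteEdges_adj]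
        exact ⟨h, huv⟩
      exact ⟨i, hadj.reachable.trans hi⟩

/-- If all blocks of a connected graph are cycles, its cycles form a cycle system. -/
theorem exists_cycleSystem [Finite V] (hG : G.Connected)
    (hblock : ∀ B : G.Subgraph, IsBlock B → IsCycleSubgraph B) :
    ∃ S : CycleSystem G {H : G.Subgraph // IsCycleSubgraph H},
      ∀ H, S.order H = Nat.card H.1.verts := by
  have hparam (H : {H : G.Subgraph // IsCycleSubgraph H}) :
      ∃ n, ∃ c : ZMod n → V, IsCycleParam H.1 n c := by
    obtain ⟨_, v, w, hw, rfl⟩ := H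
    exact ⟨_, exists_isCycleParam hw⟩
  choose n c hc using hparam
  have hproj (H : {H : G.Subgraph // IsCycleSubgraph H}) (x : V) :=
    (hc H).exists_reachable hG x
  choose π hπ using hproj
  refine ⟨⟨n, c, π, fun H => (hc H).three_le, fun H i => ((hc H).adj i).adj_sub, ?_, ?_, ?_, ?_⟩,
    fun H => (hc H).natCard_verts.symm⟩
  · intro u v huv
    obtain ⟨x, w, hw, hadj⟩ := exists_isCycle_adj hblock huv
    exact ⟨⟨_, x, w, hw, rfl⟩, ((hc _).adj_iff u v).mp hadj⟩
  · intro H K i j heq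
    have h1 := (hc H).adj i
    have h2 : K.1.Adj (c H i) (c H (i + 1)) := ((hc K).adj_iff _ _).mpr ⟨j, heq⟩
    obtain ⟨_, u, w, hw, rfl⟩ := H
    obtain ⟨_, v, w', hw', rfl⟩ := K
    exact Subtype.ext (toSubgraph_eq_of_adj hblock hw hw' h1 h2)
  · intro H i
    exact ((hc H).eq_of_reachable hblock H.2 (hπ H _)).symm
  · intro u v huv H hne
    have hadj : (G.deleteEdges H.1.edgeSet).Adj u v := by
      rw [SimpleGraph.deleteEdges_adj]
      refine ⟨huv, fun h => ?_⟩
      obtain ⟨i, hi⟩ := ((hc H).adj_iff u v).mp h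
      exact hne i hi
    exact (hc H).eq_of_reachable hblock H.2
      ((hπ H u).symm.trans (hadj.reachable.trans (hπ H v)))

end Blocks

end SzegedCactus

theorem theorem4p2 {V : Type*} [Fintype V] (G : SimpleGraph V) (hG : G.Connected)
    (hblock : ∀ B : G.Subgraph, SzegedCactus.IsBlock B → SzegedCactus.IsCycleSubgraph B) :
    2 * SzegedCactus.wienerIndex G ≤ SzegedCactus.revisedSzegedIndex G ∧
      (2 * SzegedCactus.wienerIndex G = SzegedCactus.revisedSzegedIndex G ↔
        ∀ (v : V) (c : G.Walk v v), c.IsCycle → Even c.length) := by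
  classical
  obtain ⟨S, hS⟩ := SzegedCactus.exists_cycleSystem hG hblock
  have : Fintype {H : G.Subgraph // SzegedCactus.IsCycleSubgraph H} := Fintype.ofFinite _
  have horder {v : V} {w : G.Walk v v} (hw : w.IsCycle) :
      S.order ⟨w.toSubgraph, v, w, hw, rfl⟩ = w.length := by
    obtain ⟨c, hc⟩ := SzegedCactus.exists_isCycleParam hw
    rw [hS, hc.natCard_verts]
  have hnonneg (H : {H : G.Subgraph // SzegedCactus.IsCycleSubgraph H}) (u v : V) :
      (0 : ℚ) ≤ if Odd (S.order H) ∧ S.proj H u = S.proj H v then 1 else 0 := by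
    split_ifs <;> norm_num
  have hsum := Finset.sum_nonneg fun H (_ : H ∈ Finset.univ) =>
    Finset.sum_nonneg fun u (_ : u ∈ Finset.univ) =>
      Finset.sum_nonneg fun v (_ : v ∈ Finset.univ) => hnonneg H u v
  rw [S.revisedSzegedIndex_eq hG]
  refine ⟨by linarith, ?_⟩
  rw [left_eq_add, mul_eq_zero_iff_left (by norm_num), Finset.sum_eq_zero_iff_of_nonneg
    fun H _ => Finset.sum_nonneg fun u _ => Finset.sum_nonneg fun v _ => hnonneg H u v]
  constructor
  · intro h v w hw
    by_contra hodd
    rw [Nat.not_even_iff_odd] at hodd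
    have h1 := h ⟨w.toSubgraph, v, w, hw, rfl⟩ (Finset.mem_univ _)
    rw [Finset.sum_eq_zero_iff_of_nonneg fun u _ => Finset.sum_nonneg fun v _ => hnonneg _ u v]
      at h1
    -- The diagonal pair `(v, v)` always has equal projections.
    have h2 := h1 v (Finset.mem_univ _)
    rw [Finset.sum_eq_zero_iff_of_nonneg fun v _ => hnonneg _ _ v] at h2
    have h3 := h2 v (Finset.mem_univ _)
    rw [if_pos ⟨(horder hw).symm ▸ hodd, rfl⟩] at h3
    exact one_ne_zero h3
  · rintro h ⟨_, v, w, hw, rfl⟩ _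
    have h1 := h v w hw
    rw [← horder hw, ← Nat.not_odd_iff_even] at h1
    simp [h1]
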